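/- **Theorem 4.1.** Let $N\ge 2$, let $\Omega\subset\mathbb R^N$ be a bounded smooth domain, let $1<p<\infty$ and let $w\in A_p$ be a Muckenhoupt weight on $\mathbb R^N$; that is, $w$ is locally integrable, $0<w<\infty$ a.e., and for some constant $C>0$, $$\Big(\frac1{|B|}\int_B w\,dx\Big)\Big(\frac1{|B|}\int_B w^{-\frac1{p-1}}\,dx\Big)^{p-1}\le C\quad\text{for all balls } B\subset\mathbb R^N.$$ Let $\mathcal A:\Omega\times\mathbb R^N\to\mathbb R^N$ be such that $\mathcal A(x,\cdot)$ is continuous for a.e. $x\in\Omega$ and $\mathcal A(\cdot,\zeta)$ is measurable for every $\zeta\in\mathbb R^N$, and such that, for a.e. $x\in\Omega$ and all $\zeta,\zeta_1,\zeta_2\in\mathbb R^N$, $t\in\mathbb R\setminus\{0\}$: - $|\mathcal A(x,\zeta)|\le|\zeta|^{p-1}w(x)$; - $\mathcal A(x,\zeta)\cdot\zeta\ge|\zeta|^pw(x)$; - $\mathcal A(x,t\zeta)=t|t|^{p-2}\mathcal A(x,\zeta)$; - $(\mathcal A(x,\zeta_1)-\mathcal A(x,\zeta_2))\cdot(\zeta_1-\zeta_2)\ge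 c\,|\zeta_1-\zeta_2|^{\gamma}\,\overline{\mathcal A}(x,\zeta_1,\zeta_2)^{1-\gamma/p}\,w(x)$ whenever $\zeta_1\ne\zeta_2$, where $\gamma=\max\{p,2\}$, $c>0$ is a constant and $\overline{\mathcal A}(x,\zeta_1,\zeta_2)=\frac1{w(x)}\big(\mathcal A(x,\zeta_1)\cdot\zeta_1+\mathcal A(x,\zeta_2)\cdot\zeta_2\big)$. Let $W^{1,p}(\Omega,w)$ be the space of measurable functions $u$ on $\Omega$ (modulo equality a.e.) with distributional gradient such that $\|u\|_{1,p,w}=\big(\int_\Omega|u|^pw\,dx\big)^{1/p}+\big(\int_\Omega|\nabla u|^pw\,dx\big)^{1/p}<\infty$, let $X=W_0^{1,p}(\Omega,w)$ be the closure of $C_c^\infty(\Omega)$ in it, and let $W^{1,p}_{loc}(\Omega,w)$ be the set of functions that belong to $W^{1,p}(\Omega',w)$ for every open $\Omega'\subset\subset\Omega$. Let $0<\delta\le1$ and let $f\in L^1(\Omega)$ be nonnegative. A *weak solution* of the problem $$-\operatorname{div}\mathcal A(x,\nabla u)=\frac f{u^\delta}\ \text{ in }\Omega,\qquad u>0\ \text{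 in }\Omega,\qquad u=0\ \text{ on }\partial\Omega\tag{1.1}$$ is a function $u\in W^{1,p}_{loc}(\Omega,w)$ with $u>0$ a.e. in $\Omega$ such that for every compact $K\subset\Omega$ there is $c_K>0$ with $u\ge c_K$ a.e. in $K$, such that $u^\alpha\in X$ for some $\alpha\ge1$ (the meaning of $u=0$ on $\partial\Omega$), and such that $$\int_\Omega\mathcal A(x,\nabla u)\cdot\nabla\phi\,dx=\int_\Omega\frac f{u^\delta}\,\phi\,dx\qquad\text{for all }\phi\in C^1_c(\Omega).$$ Then problem (1.1) has at most one weak solution belonging to $X$: if $u_1,u_2\in X$ are weak solutions of (1.1), then $u_1=u_2$ a.e. in $\Omega$. -/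

import Mathlib

open MeasureTheory Set Filter Topology
open scoped ENNReal ContDiff

noncomputable section

namespace SingularWeighted

/-- The Euclidean space of dimension `N`. -/
abbrev RN (N : ℕ) : Type := EuclideanSpace ℝ (Fin N)

variable {N : ℕ}

/-- A bounded smooth domain: a nonempty, bounded, connected open set which near each of its boundary
points is the sublevel set of a smooth function with nonvanishing differential. -/
structure IsBoundedSmoothDomain (Ω : Set (RN N)) : Prop where
  isOpen : IsOpen Ω
  isConnected : IsConnected Ω
  isBounded : Bornology.IsBounded Ω
  smooth_boundary : ∀ x ∈ frontier Ω, ∃ (U : Set (RN N)) (ρ : RN N → ℝ),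
    IsOpen U ∧ x ∈ U ∧ ContDiffOn ℝ ∞ ρ U ∧ fderiv ℝ ρ x ≠ 0 ∧ Ω ∩ U = {y ∈ U | ρ y < 0}

/-- The Muckenhoupt class `A_p`. The averages are taken in `[0,∞]`, so that the bound entails
their finiteness. -/
structure IsMuckenhoupt (p : ℝ) (w : RN N → ℝ) : Prop where
  locallyIntegrable : LocallyIntegrable w volume
  pos : ∀ᵐ x, 0 < w x
  bound : ∃ c : ℝ, 0 < c ∧ ∀ (x₀ : RN N) (r : ℝ), 0 < r →
    (⨍⁻ x in Metric.ball x₀ r, ENNReal.ofReal (w x) ∂volume) *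
      (⨍⁻ x in Metric.ball x₀ r, ENNReal.ofReal (w x ^ (-(1 / (p - 1)))) ∂volume) ^ (p - 1)
      ≤ ENNReal.ofReal c

/-- The measure `w(x) dx` on `Ω`. -/
def weightedMeasure (w : RN N → ℝ) (Ω : Set (RN N)) : Measure (RN N) :=
  (volume.restrict Ω).withDensity (fun x => ENNReal.ofReal (w x))

/-- Functions of class `C^n` with compact support in `Ω`. -/
def IsTestFunction (n : WithTop ℕ∞) (Ω : Set (RN N)) (φ : RN N → ℝ) : Prop :=
  ContDiff ℝ n φ ∧ HasCompactSupport φ ∧ tsupport φ ⊆ Ω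

/-- `g` is the distributional gradient of `u` in `Ω`. -/
def HasWeakGradient (Ω : Set (RN N)) (u : RN N → ℝ) (g : RN N → RN N) : Prop :=
  LocallyIntegrableOn u Ω ∧ LocallyIntegrableOn g Ω ∧
    ∀ φ : RN N → ℝ, IsTestFunction ∞ Ω φ →
      ∫ x in Ω, u x • gradient φ x = -∫ x in Ω, φ x • g x

/-- `u ∈ W^{1,p}(Ω,w)`. -/
def MemW1p (p : ℝ) (w : RN N → ℝ) (Ω : Set (RN N)) (u : RN N → ℝ) : Prop :=
  ∃ g : RN N → RN N, HasWeakGradient Ω u g ∧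
    MemLp u (ENNReal.ofReal p) (weightedMeasure w Ω) ∧
    MemLp g (ENNReal.ofReal p) (weightedMeasure w Ω)

/-- `u ∈ W^{1,p}_loc(Ω,w)`. -/
def MemW1pLoc (p : ℝ) (w : RN N → ℝ) (Ω : Set (RN N)) (u : RN N → ℝ) : Prop :=
  ∀ Ω' : Set (RN N), IsOpen Ω' → IsCompact (closure Ω') → closure Ω' ⊆ Ω → MemW1p p w Ω' u

/-- `u ∈ X = W_0^{1,p}(Ω,w)`, the closure of `C_c^∞(Ω)` in `W^{1,p}(Ω,w)`. -/
def MemW1p0 (p : ℝ) (w : RN N → ℝ) (Ω : Set (RN N)) (u : RN N → ℝ) : Prop :=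
  ∃ g : RN N → RN N, HasWeakGradient Ω u g ∧
    MemLp u (ENNReal.ofReal p) (weightedMeasure w Ω) ∧
    MemLp g (ENNReal.ofReal p) (weightedMeasure w Ω) ∧
    ∃ φ : ℕ → RN N → ℝ, (∀ n, IsTestFunction ∞ Ω (φ n)) ∧
      Tendsto (fun n => eLpNorm (fun x => u x - φ n x) (ENNReal.ofReal p) (weightedMeasure w Ω))
        atTop (𝓝 0) ∧
      Tendsto (fun n => eLpNorm (fun x => g x - gradient (φ n) x) (ENNReal.ofReal p)
        (weightedMeasure w Ω)) atTop (𝓝 0)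

/-- The quantity `(⟨A(x,ζ₁),ζ₁⟩ + ⟨A(x,ζ₂),ζ₂⟩) / w(x)`. -/
def Abar (w : RN N → ℝ) (A : RN N → RN N → RN N) (x ζ₁ ζ₂ : RN N) : ℝ :=
  1 / w x * (inner ℝ (A x ζ₁) ζ₁ + inner ℝ (A x ζ₂) ζ₂)

/-- The standing hypotheses on the vector field `A : Ω × ℝ^N → ℝ^N`: it is a Carathéodory function
satisfying growth, degeneracy, homogeneity and strong monotonicity conditions. -/
structure IsAdmissible (p : ℝ) (w : RN N → ℝ) (Ω : Set (RN N)) (A : RN N → RN N → RN N) :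
    Prop where
  continuous : ∀ᵐ x ∂volume.restrict Ω, Continuous (A x)
  measurable : ∀ ζ : RN N, AEMeasurable (fun x => A x ζ) (volume.restrict Ω)
  growth : ∀ᵐ x ∂volume.restrict Ω, ∀ ζ : RN N, ‖A x ζ‖ ≤ ‖ζ‖ ^ (p - 1) * w x
  degeneracy : ∀ᵐ x ∂volume.restrict Ω, ∀ ζ : RN N, ‖ζ‖ ^ p * w x ≤ inner ℝ (A x ζ) ζ
  homogeneity : ∀ᵐ x ∂volume.restrict Ω, ∀ (ζ : RN N) (t : ℝ), t ≠ 0 →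
    A x (t • ζ) = (t * |t| ^ (p - 2)) • A x ζ
  strong_monotonicity : ∃ c : ℝ, 0 < c ∧ ∀ᵐ x ∂volume.restrict Ω, ∀ ζ₁ ζ₂ : RN N,
    c * ‖ζ₁ - ζ₂‖ ^ (max p 2) * (Abar w A x ζ₁ ζ₂) ^ (1 - max p 2 / p) * w x
      ≤ inner ℝ (A x ζ₁ - A x ζ₂) (ζ₁ - ζ₂)

/-- `u` is a weak solution of `-div A(x,∇u) = f / u^δ` in `Ω`, `u > 0` in `Ω`, `u = 0` on `∂Ω`.
The boundary condition means that some power `u^α` with `α ≥ 1` belongs to `W_0^{1,p}(Ω,w)`. -/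
structure IsWeakSolution (p : ℝ) (w : RN N → ℝ) (Ω : Set (RN N)) (A : RN N → RN N → RN N)
    (δ : ℝ) (f u : RN N → ℝ) : Prop where
  mem_loc : MemW1pLoc p w Ω u
  pos : ∀ᵐ x ∂volume.restrict Ω, 0 < u x
  locally_pos : ∀ K : Set (RN N), IsCompact K → K ⊆ Ω →
    ∃ c : ℝ, 0 < c ∧ ∀ᵐ x ∂volume.restrict K, c ≤ u x
  boundary : ∃ α : ℝ, 1 ≤ α ∧ MemW1p0 p w Ω (fun x => u x ^ α)
  equation : ∃ g : RN N → RN N, HasWeakGradient Ω u g ∧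
    ∀ φ : RN N → ℝ, IsTestFunction 1 Ω φ →
      ∫ x in Ω, inner ℝ (A x (g x)) (gradient φ x) = ∫ x in Ω, f x / u x ^ δ * φ x

end SingularWeighted

end

/-! Write d = u₁ - u₂, with weak gradient G = g₁ - g₂. Monotonicity of `A` and the decrease of t ↦
f/t^δ have opposite signs when the two equations are subtracted and tested with an increasing
function of d. Two obstacles prevent using d itself: it is not a C¹ function with compact support,
and f/u^δ is only known to be integrable on compact sets, where u is bounded below.

Both are met by a double limit. Test functions φₙ converge to d a.e., with gradients converging in
L^p(w). The equations are tested with arctan²(ψ) arctan(φₙ) for a fixed test function ψ, whose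
support keeps the singular terms integrable; n → ∞ gives a right-hand side ≤ 0
(`IsWeakSolution.integral_test_le_zero`). Only then is ψ = φₙ chosen, and a second limit gives 3 ∫
⟨A(x,g₁) - A(x,g₂), G⟩ arctan²(d)/(1 + d²) ≤ 0. Strict monotonicity yields G = 0 wherever d ≠ 0
(`IsWeakSolution.gradient_sub_eq_zero`).

To conclude d = 0, the field F(x) = ⟨e,x⟩e of divergence 1 is integrated against ∇ arctan²(φₙ)
(`ae_eq_zero_of_gradient_eq_zero`). In the limit, -∫ arctan²(d) = ∫ F·G · 2 arctan(d)/(1 + d²) = 0.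
The `A_p` condition makes F an admissible functional on L^p(w). Only C¹ functions are ever
differentiated, so neither a Sobolev chain rule nor a Poincaré inequality is needed; arctan supplies
bounded, smooth multipliers. -/

noncomputable section

namespace SingularWeighted

variable {N : ℕ}

/-! ### Limits of integrals of products -/

/-- The integral of a product is continuous when one factor converges in `L¹` and the other one is
bounded and converges almost everywhere. -/
theorem tendsto_integral_mul_of_tendsto_eLpNorm_one {α : Type*} [MeasurableSpace α] {μ : Measure α}
    {a b : ℕ → α → ℝ} {a₀ b₀ : α → ℝ} {C : ℝ}
    (ha : ∀ n, Integrable (a n) μ) (ha₀ : Integrable a₀ μ)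
    (hlim : Tendsto (fun n => eLpNorm (fun x => a n x - a₀ x) 1 μ) atTop (𝓝 0))
    (hb : ∀ n, AEStronglyMeasurable (b n) μ) (hbC : ∀ n, ∀ᵐ x ∂μ, ‖b n x‖ ≤ C)
    (hblim : ∀ᵐ x ∂μ, Tendsto (fun n => b n x) atTop (𝓝 (b₀ x))) :
    Tendsto (fun n => ∫ x, a n x * b n x ∂μ) atTop (𝓝 (∫ x, a₀ x * b₀ x ∂μ)) := by
  -- Split aₙbₙ = (aₙ - a₀)bₙ + a₀bₙ: the first term is at most C‖aₙ - a₀‖₁, the second converges by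
  -- domination.
  have h₁ : Tendsto (fun n => ∫ x, (a n x - a₀ x) * b n x ∂μ) atTop (𝓝 0) := by
    have hC : Tendsto (fun n => ∫ x, C * ‖a n x - a₀ x‖ ∂μ) atTop (𝓝 0) := by
      have h := (ENNReal.tendsto_toReal ENNReal.zero_ne_top).comp hlim
      have h' := h.const_mul C
      simp only [ENNReal.toReal_zero, mul_zero] at h'
      refine h'.congr fun n => ?_
      rw [integral_const_mul]
      simp only [Function.comp_apply, eLpNorm_one_eq_lintegral_enorm]
      rw [integral_norm_eq_lintegral_enorm (f := fun x => a n x - a₀ x)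
        ((ha n).sub ha₀).aestronglyMeasurable]
    refine squeeze_zero_norm (fun n => ?_) hC
    refine norm_integral_le_of_norm_le (((ha n).sub ha₀).norm.const_mul C) ?_
    filter_upwards [hbC n] with x hx
    rw [norm_mul, mul_comm]
    exact mul_le_mul_of_nonneg_right hx (norm_nonneg _)
  have h₂ : Tendsto (fun n => ∫ x, a₀ x * b n x ∂μ) atTop (𝓝 (∫ x, a₀ x * b₀ x ∂μ)) := by
    refine tendsto_integral_of_dominated_convergence (fun x => C * ‖a₀ x‖)
      (fun n => ha₀.aestronglyMeasurable.mul (hb n)) (ha₀.norm.const_mul C) (fun n => ?_) ?_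
    · filter_upwards [hbC n] with x hx
      rw [norm_mul, mul_comm]
      exact mul_le_mul_of_nonneg_right hx (norm_nonneg _)
    · filter_upwards [hblim] with x hx
      exact hx.const_mul _
  have h := h₁.add h₂
  rw [zero_add] at h
  refine h.congr fun n => ?_
  rw [← integral_add]
  · exact integral_congr_ae (Eventually.of_forall fun x => by ring)
  · exact ((ha n).sub ha₀).mul_bdd (hb n) (hbC n)
  · exact ha₀.mul_bdd (hb n) (hbC n)

/-! ### Calculus of test functions -/

theorem IsTestFunction.mono {m n : WithTop ℕ∞} {Ω : Set (RN N)} {φ : RN N → ℝ}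
    (hφ : IsTestFunction n Ω φ) (h : m ≤ n) : IsTestFunction m Ω φ :=
  ⟨hφ.1.of_le h, hφ.2⟩

theorem IsTestFunction.sub {n : WithTop ℕ∞} {Ω : Set (RN N)} {φ ψ : RN N → ℝ}
    (hφ : IsTestFunction n Ω φ) (hψ : IsTestFunction n Ω ψ) :
    IsTestFunction n Ω (fun x => φ x - ψ x) :=
  ⟨hφ.1.sub hψ.1, hφ.2.1.sub hψ.2.1,
    (tsupport_sub φ ψ).trans (union_subset hφ.2.2 hψ.2.2)⟩

theorem continuous_gradient_of_contDiff {φ : RN N → ℝ} (h : ContDiff ℝ 1 φ) :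
    Continuous (gradient φ) :=
  (InnerProductSpace.toDual ℝ (RN N)).symm.continuous.comp (h.continuous_fderiv one_ne_zero)

theorem hasCompactSupport_gradient {φ : RN N → ℝ} (h : HasCompactSupport φ) :
    HasCompactSupport (gradient φ) :=
  (h.fderiv ℝ).comp_left (g := (InnerProductSpace.toDual ℝ (RN N)).symm) (map_zero _)

theorem gradient_sub_of_contDiff {φ ψ : RN N → ℝ} (hφ : ContDiff ℝ 1 φ) (hψ : ContDiff ℝ 1 ψ)
    (x : RN N) : gradient (fun y => φ y - ψ y) x = gradient φ x - gradient ψ x := by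
  have h₁ := (hφ.differentiable one_ne_zero x)
  have h₂ := (hψ.differentiable one_ne_zero x)
  simp only [gradient]
  rw [fderiv_fun_sub h₁ h₂, map_sub]

theorem gradient_comp_mul_comp {φ ψ : RN N → ℝ} (hφ : ContDiff ℝ 1 φ) (hψ : ContDiff ℝ 1 ψ)
    {S T S' T' : ℝ → ℝ} (hS : ∀ t, HasDerivAt S (S' t) t) (hT : ∀ t, HasDerivAt T (T' t) t)
    (x : RN N) :
    gradient (fun y => S (φ y) * T (ψ y)) x =
      (S' (φ x) * T (ψ x)) • gradient φ x + (S (φ x) * T' (ψ x)) • gradient ψ x := by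
  have h₁ := (hS (φ x)).comp_hasFDerivAt x (hφ.differentiable one_ne_zero x).hasFDerivAt
  have h₂ := (hT (ψ x)).comp_hasFDerivAt x (hψ.differentiable one_ne_zero x).hasFDerivAt
  have h₃ := (h₁.mul h₂).fderiv
  simp only [gradient]
  rw [show (fun y => S (φ y) * T (ψ y)) = (S ∘ φ) * (T ∘ ψ) from rfl, h₃]
  simp only [map_add, map_smulₛₗ, Function.comp_apply, smul_smul]
  simp only [conj_trivial]
  rw [add_comm, mul_comm (T (ψ x))]

/-! ### The weighted measure and duality with L^p(w) -/

/-- The weighted measure and the restricted Lebesgue measure have the same null sets. -/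
theorem restrict_absolutelyContinuous_weightedMeasure {p : ℝ} {w : RN N → ℝ}
    (hw : IsMuckenhoupt p w) (Ω : Set (RN N)) : volume.restrict Ω ≪ weightedMeasure w Ω := by
  refine withDensity_absolutelyContinuous' ?_ ?_
  · exact (hw.locallyIntegrable.aestronglyMeasurable.aemeasurable.ennreal_ofReal).restrict
  · filter_upwards [ae_restrict_of_ae hw.pos] with x hx
    simpa using hx

theorem isFiniteMeasure_weightedMeasure {p : ℝ} {w : RN N → ℝ} (hw : IsMuckenhoupt p w)
    {Ω : Set (RN N)} (hΩ : Bornology.IsBounded Ω) : IsFiniteMeasure (weightedMeasure w Ω) := by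
  refine isFiniteMeasure_withDensity_ofReal ?_
  exact ((hw.locallyIntegrable.integrableOn_isCompact hΩ.isCompact_closure).mono_set
    subset_closure).2

theorem lintegral_weightedMeasure {p : ℝ} {w : RN N → ℝ} (hw : IsMuckenhoupt p w)
    (Ω : Set (RN N)) {h : RN N → ℝ≥0∞} (hh : AEMeasurable h (weightedMeasure w Ω)) :
    ∫⁻ x, h x ∂weightedMeasure w Ω = ∫⁻ x in Ω, ENNReal.ofReal (w x) * h x :=
  lintegral_withDensity_eq_lintegral_mul₀'
    (hw.locallyIntegrable.aestronglyMeasurable.aemeasurable.ennreal_ofReal).restrict hh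

/-- A vector field `F` dominated by `H w` with `H ∈ L^q(Ω,w)`; integration against such a field is a
continuous functional on `L^p(Ω,w)`. -/
structure IsDualField (q : ℝ) (w : RN N → ℝ) (Ω : Set (RN N)) (F : RN N → RN N) : Prop where
  measurable : AEStronglyMeasurable F (volume.restrict Ω)
  dominated : ∃ H : RN N → ℝ, MemLp H (ENNReal.ofReal q) (weightedMeasure w Ω) ∧
    ∀ᵐ x ∂volume.restrict Ω, ‖F x‖ ≤ H x * w x

theorem IsDualField.sub {q : ℝ} {w : RN N → ℝ} {Ω : Set (RN N)} {F₁ F₂ : RN N → RN N}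
    (h₁ : IsDualField q w Ω F₁) (h₂ : IsDualField q w Ω F₂) :
    IsDualField q w Ω (fun x => F₁ x - F₂ x) := by
  obtain ⟨m₁, H₁, hH₁, b₁⟩ := h₁
  obtain ⟨m₂, H₂, hH₂, b₂⟩ := h₂
  refine ⟨m₁.sub m₂, fun x => H₁ x + H₂ x, hH₁.add hH₂, ?_⟩
  filter_upwards [b₁, b₂] with x h₁ h₂
  calc ‖F₁ x - F₂ x‖ ≤ ‖F₁ x‖ + ‖F₂ x‖ := norm_sub_le _ _
    _ ≤ (H₁ x + H₂ x) * w x := by linarith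

/-- Since |F·v| ≤ |H||v|w, this is Hölder's inequality for the measure w dx; the constant is the
L^q(w) norm of H. -/
theorem IsDualField.eLpNorm_inner_le {p q : ℝ} (hpq : p.HolderConjugate q) {w : RN N → ℝ}
    (hw : IsMuckenhoupt p w) {Ω : Set (RN N)} {F : RN N → RN N} (hF : IsDualField q w Ω F) :
    ∃ C : ℝ≥0∞, C ≠ ⊤ ∧ ∀ v : RN N → RN N, AEStronglyMeasurable v (weightedMeasure w Ω) →
      eLpNorm (fun x => (inner ℝ (F x) (v x) : ℝ)) 1 (volume.restrict Ω)
        ≤ C * eLpNorm v (ENNReal.ofReal p) (weightedMeasure w Ω) := by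
  obtain ⟨m, H, hH, b⟩ := hF
  have := hpq.symm.ennrealOfReal
  refine ⟨eLpNorm H (ENNReal.ofReal q) (weightedMeasure w Ω), hH.2.ne, fun v hv => ?_⟩
  refine le_trans ?_ (eLpNorm_smul_le_mul_eLpNorm (r := 1) hv hH.1)
  rw [eLpNorm_one_eq_lintegral_enorm, eLpNorm_one_eq_lintegral_enorm,
    lintegral_weightedMeasure hw Ω (hH.1.smul hv).enorm]
  refine lintegral_mono_ae ?_
  filter_upwards [b, ae_restrict_of_ae hw.pos] with x hx hwx
  have h : ‖(inner ℝ (F x) (v x) : ℝ)‖ ≤ w x * ‖(H • v) x‖ := by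
    calc ‖(inner ℝ (F x) (v x) : ℝ)‖ ≤ ‖F x‖ * ‖v x‖ := norm_inner_le_norm _ _
      _ ≤ (H x * w x) * ‖v x‖ := by gcongr
      _ ≤ (|H x| * w x) * ‖v x‖ := by gcongr; exact le_abs_self _
      _ = w x * ‖(H • v) x‖ := by
        rw [Pi.smul_apply', norm_smul, Real.norm_eq_abs]; ring
  calc ‖(inner ℝ (F x) (v x) : ℝ)‖ₑ = ENNReal.ofReal ‖(inner ℝ (F x) (v x) : ℝ)‖ :=
        (ofReal_norm _).symm
    _ ≤ ENNReal.ofReal (w x * ‖(H • v) x‖) := ENNReal.ofReal_le_ofReal h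
    _ = _ := by rw [ENNReal.ofReal_mul hwx.le, ofReal_norm]

theorem IsDualField.integrable_inner {p q : ℝ} (hpq : p.HolderConjugate q) {w : RN N → ℝ}
    (hw : IsMuckenhoupt p w) {Ω : Set (RN N)} {F : RN N → RN N} (hF : IsDualField q w Ω F)
    {v : RN N → RN N} (hv : MemLp v (ENNReal.ofReal p) (weightedMeasure w Ω)) :
    IntegrableOn (fun x => (inner ℝ (F x) (v x) : ℝ)) Ω := by
  obtain ⟨C, hC, h⟩ := hF.eLpNorm_inner_le hpq hw
  refine memLp_one_iff_integrable.1 ⟨?_, (h v hv.1).trans_lt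
    (ENNReal.mul_lt_top hC.lt_top hv.2)⟩
  exact hF.measurable.inner (hv.1.mono_ac (restrict_absolutelyContinuous_weightedMeasure hw Ω))

theorem IsDualField.tendsto_inner {p q : ℝ} (hpq : p.HolderConjugate q) {w : RN N → ℝ}
    (hw : IsMuckenhoupt p w) {Ω : Set (RN N)} {F : RN N → RN N} (hF : IsDualField q w Ω F)
    {v : ℕ → RN N → RN N} {v₀ : RN N → RN N}
    (hv : ∀ n, MemLp (v n) (ENNReal.ofReal p) (weightedMeasure w Ω))
    (hv₀ : MemLp v₀ (ENNReal.ofReal p) (weightedMeasure w Ω))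
    (hlim : Tendsto (fun n => eLpNorm (fun x => v₀ x - v n x) (ENNReal.ofReal p)
      (weightedMeasure w Ω)) atTop (𝓝 0)) :
    Tendsto (fun n => eLpNorm (fun x => (inner ℝ (F x) (v n x) : ℝ) - inner ℝ (F x) (v₀ x)) 1
      (volume.restrict Ω)) atTop (𝓝 0) := by
  obtain ⟨C, hC, h⟩ := hF.eLpNorm_inner_le hpq hw
  have hlim' := ENNReal.Tendsto.const_mul hlim (a := C) (Or.inr hC)
  rw [mul_zero] at hlim'
  refine tendsto_of_tendsto_of_tendsto_of_le_of_le tendsto_const_nhds hlim'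
    (fun n => zero_le) fun n => ?_
  refine le_trans (le_of_eq ?_) (h (fun x => v₀ x - v n x) (hv₀.1.sub (hv n).1))
  rw [← eLpNorm_neg]
  congr 1
  ext x
  simp [inner_sub_right]

theorem IsTestFunction.memLp_gradient {p : ℝ} {w : RN N → ℝ} (hw : IsMuckenhoupt p w)
    {Ω : Set (RN N)} (hΩ : Bornology.IsBounded Ω) {φ : RN N → ℝ} (hφ : IsTestFunction 1 Ω φ) :
    MemLp (gradient φ) (ENNReal.ofReal p) (weightedMeasure w Ω) := by
  have := isFiniteMeasure_weightedMeasure hw hΩ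
  exact (continuous_gradient_of_contDiff hφ.1).memLp_of_hasCompactSupport
    (hasCompactSupport_gradient hφ.2.1)

/-! ### Weak gradients and approximation by test functions -/

/-- Allows the gradient in the weak formulation to be replaced by the one that test functions
approximate in L^p(w). -/
theorem HasWeakGradient.ae_eq {Ω : Set (RN N)} (hΩ : IsOpen Ω) {u : RN N → ℝ}
    {g g' : RN N → RN N} (h : HasWeakGradient Ω u g) (h' : HasWeakGradient Ω u g') :
    ∀ᵐ x ∂volume.restrict Ω, g x = g' x := by
  rw [ae_restrict_iff' hΩ.measurableSet]
  have key := hΩ.ae_eq_zero_of_integral_contDiff_smul_eq_zero (μ := volume)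
    (h.2.1.sub h'.2.1) (fun φ hφ hφc hφs => ?_)
  · filter_upwards [key] with x hx hxΩ
    exact sub_eq_zero.1 (hx hxΩ)
  · have hint : ∀ {k : RN N → RN N}, LocallyIntegrableOn k Ω →
        Integrable (fun x => φ x • k x) volume := fun {k} hk => by
      have h₁ : IntegrableOn (fun x => φ x • k x) (tsupport φ) :=
        (hk.integrableOn_compact_subset hφs hφc).continuousOn_smul hφ.continuous.continuousOn hφc
      refine (integrableOn_iff_integrable_of_support_subset ?_).1 h₁
      exact (Function.support_smul_subset_left _ _).trans (subset_tsupport φ)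
    have heq : ∀ k : RN N → RN N, ∫ x in Ω, φ x • k x = ∫ x, φ x • k x := fun k => by
      refine setIntegral_eq_integral_of_forall_compl_eq_zero fun x hx => ?_
      rw [image_eq_zero_of_notMem_tsupport fun hx' => hx (hφs hx'), zero_smul]
    have e := h.2.2 φ ⟨hφ, hφc, hφs⟩
    rw [h'.2.2 φ ⟨hφ, hφc, hφs⟩, neg_inj, heq, heq] at e
    simp only [Pi.sub_apply, smul_sub]
    rw [integral_sub (hint h.2.1) (hint h'.2.1), e, sub_self]

/-- The difference of two elements of `W_0^{1,p}(Ω,w)` is the limit of test functions almost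
everywhere, with convergence of the gradients in `L^p(Ω,w)`. -/
theorem exists_testFunction_tendsto_sub {p : ℝ} (hp : 1 < p) {w : RN N → ℝ}
    (hw : IsMuckenhoupt p w) {Ω : Set (RN N)} {u₁ u₂ : RN N → ℝ}
    (h₁ : MemW1p0 p w Ω u₁) (h₂ : MemW1p0 p w Ω u₂) :
    ∃ (g₁ g₂ : RN N → RN N) (φ : ℕ → RN N → ℝ), HasWeakGradient Ω u₁ g₁ ∧
      HasWeakGradient Ω u₂ g₂ ∧ MemLp g₁ (ENNReal.ofReal p) (weightedMeasure w Ω) ∧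
      MemLp g₂ (ENNReal.ofReal p) (weightedMeasure w Ω) ∧ (∀ n, IsTestFunction ∞ Ω (φ n)) ∧
      (∀ᵐ x ∂volume.restrict Ω, Tendsto (fun n => φ n x) atTop (𝓝 (u₁ x - u₂ x))) ∧
      Tendsto (fun n => eLpNorm (fun x => (g₁ x - g₂ x) - gradient (φ n) x) (ENNReal.ofReal p)
        (weightedMeasure w Ω)) atTop (𝓝 0) := by
  obtain ⟨g₁, hg₁, hu₁, hgp₁, φ₁, hφ₁, hc₁, hgc₁⟩ := h₁
  obtain ⟨g₂, hg₂, hu₂, hgp₂, φ₂, hφ₂, hc₂, hgc₂⟩ := h₂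
  have hP : 1 ≤ ENNReal.ofReal p := by
    rw [← ENNReal.ofReal_one]; exact ENNReal.ofReal_le_ofReal hp.le
  have hP0 : ENNReal.ofReal p ≠ 0 := (zero_lt_one.trans_le hP).ne'
  have m : ∀ {φ : RN N → ℝ}, IsTestFunction ∞ Ω φ →
      AEStronglyMeasurable φ (weightedMeasure w Ω) := fun h => h.1.continuous.aestronglyMeasurable
  have mg : ∀ {φ : RN N → ℝ}, IsTestFunction ∞ Ω φ →
      AEStronglyMeasurable (gradient φ) (weightedMeasure w Ω) := fun h =>
    (continuous_gradient_of_contDiff (h.1.of_le (by simp))).aestronglyMeasurable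
  have hc : Tendsto (fun n => eLpNorm ((fun x => φ₁ n x - φ₂ n x) - fun x => u₁ x - u₂ x)
      (ENNReal.ofReal p) (weightedMeasure w Ω)) atTop (𝓝 0) := by
    have hs := hc₂.add hc₁
    rw [add_zero] at hs
    refine tendsto_of_tendsto_of_tendsto_of_le_of_le tendsto_const_nhds hs (fun n => zero_le)
      fun n => ?_
    refine le_trans (le_of_eq ?_) (eLpNorm_sub_le (hu₂.1.sub (m (hφ₂ n)))
      (hu₁.1.sub (m (hφ₁ n))) hP)
    congr 1
    ext x
    simp only [Pi.sub_apply]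
    ring
  -- Convergence in L^p(w) gives a.e. convergence along a subsequence; the gradients still converge
  -- along it.
  obtain ⟨ns, hns, hae⟩ := (tendstoInMeasure_of_tendsto_eLpNorm hP0
    (fun n => (m (hφ₁ n)).sub (m (hφ₂ n))) (hu₁.1.sub hu₂.1) hc).exists_seq_tendsto_ae
  refine ⟨g₁, g₂, fun k x => φ₁ (ns k) x - φ₂ (ns k) x, hg₁, hg₂, hgp₁, hgp₂,
    fun k => (hφ₁ _).sub (hφ₂ _),
    (restrict_absolutelyContinuous_weightedMeasure hw Ω).ae_le hae, ?_⟩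
  have hs := (hgc₁.add hgc₂).comp hns.tendsto_atTop
  rw [add_zero] at hs
  refine tendsto_of_tendsto_of_tendsto_of_le_of_le tendsto_const_nhds hs (fun n => zero_le)
    fun n => ?_
  refine le_trans (le_of_eq ?_) (eLpNorm_sub_le (hgp₁.1.sub (mg (hφ₁ (ns n))))
    (hgp₂.1.sub (mg (hφ₂ (ns n)))) hP)
  congr 1
  ext1 x
  simp only [Pi.sub_apply]
  rw [gradient_sub_of_contDiff ((hφ₁ _).1.of_le (by simp)) ((hφ₂ _).1.of_le (by simp))]
  abel

/-! ### The fluxes and bounded fields as functionals on L^p(w) -/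

/-- A Carathéodory function composed with a measurable one is measurable. -/
theorem aestronglyMeasurable_comp_of_caratheodory {E : Type*} [NormedAddCommGroup E]
    [MeasurableSpace E] [BorelSpace E] [SecondCountableTopology E]
    {μ : Measure E} {A : E → E → E} (hc : ∀ᵐ x ∂μ, Continuous (A x))
    (hm : ∀ ζ, AEMeasurable (fun x => A x ζ) μ) {g : E → E} (hg : AEStronglyMeasurable g μ) :
    AEStronglyMeasurable (fun x => A x (g x)) μ := by
  obtain ⟨g', hg', hgg'⟩ := hg
  have hs : ∀ s : SimpleFunc E E, AEStronglyMeasurable (fun x => A x (s x)) μ := fun s => by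
    have : (fun x => A x (s x)) =
        fun x => ∑ y ∈ s.range, (s ⁻¹' {y}).indicator (fun x => A x y) x := by
      ext1 x
      rw [Finset.sum_eq_single (s x)]
      · exact (indicator_of_mem (show x ∈ s ⁻¹' {s x} from rfl) fun z => A z (s x)).symm
      · intro y _ hy
        exact indicator_of_notMem (fun h : s x = y => hy h.symm) _
      · intro h
        exact absurd (s.mem_range_self x) h
    rw [this]
    exact Finset.aestronglyMeasurable_fun_sum _ fun y _ =>
      ((hm y).aestronglyMeasurable.indicator (s.measurableSet_fiber y))
  refine aestronglyMeasurable_of_tendsto_ae atTop (fun n => hs (hg'.approx n)) ?_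
  filter_upwards [hc, hgg'] with x hx hgx
  rw [hgx]
  exact (hx.tendsto _).comp (hg'.tendsto_approx x)

/-- By the growth bound one may take H = |g|^(p-1), which lies in L^q(w) because q = p/(p-1). -/
theorem IsAdmissible.isDualField {p q : ℝ} (hpq : p.HolderConjugate q) {w : RN N → ℝ}
    (hw : IsMuckenhoupt p w) {Ω : Set (RN N)} {A : RN N → RN N → RN N}
    (hA : IsAdmissible p w Ω A) {g : RN N → RN N}
    (hg : MemLp g (ENNReal.ofReal p) (weightedMeasure w Ω)) :
    IsDualField q w Ω (fun x => A x (g x)) := by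
  refine ⟨aestronglyMeasurable_comp_of_caratheodory hA.continuous hA.measurable
    (hg.1.mono_ac (restrict_absolutelyContinuous_weightedMeasure hw Ω)),
    fun x => ‖g x‖ ^ (p - 1), ?_, ?_⟩
  · have h := hg.norm_rpow_div (ENNReal.ofReal (p - 1))
    rw [ENNReal.toReal_ofReal hpq.sub_one_pos.le, ← ENNReal.ofReal_div_of_pos hpq.sub_one_pos,
      ← hpq.conjugate_eq] at h
    exact h
  · filter_upwards [hA.growth] with x hx using hx _

/-- On a ball containing Ω the mean of w is nonzero, so an infinite dual mean would make the `A_p`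
product infinite. -/
theorem IsMuckenhoupt.lintegral_rpow_lt_top {p : ℝ} (hp : 1 < p) {w : RN N → ℝ}
    (hw : IsMuckenhoupt p w) {Ω : Set (RN N)} (hΩ : Bornology.IsBounded Ω) :
    ∫⁻ x in Ω, ENNReal.ofReal (w x ^ (-(1 / (p - 1)))) < ⊤ := by
  obtain ⟨r, hr, hΩr⟩ := hΩ.subset_ball_lt 0 (0 : RN N)
  obtain ⟨c, hc, hb⟩ := hw.bound
  refine (lintegral_mono_set hΩr).trans_lt ?_
  have hB0 : volume (Metric.ball (0 : RN N) r) ≠ 0 := (Metric.measure_ball_pos volume _ hr).ne'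
  have hBt : volume (Metric.ball (0 : RN N) r) ≠ ⊤ := measure_ball_lt_top.ne
  have h₁ : (⨍⁻ x in Metric.ball (0 : RN N) r, ENNReal.ofReal (w x) ∂volume) ≠ 0 := by
    rw [setLAverage_eq]
    refine ENNReal.div_ne_zero.2 ⟨?_, hBt⟩
    intro h0
    rw [lintegral_eq_zero_iff' (hw.locallyIntegrable.aestronglyMeasurable.aemeasurable
      |>.ennreal_ofReal).restrict] at h0
    have hfalse : ∀ᵐ x ∂volume.restrict (Metric.ball (0 : RN N) r), False := by
      filter_upwards [h0, ae_restrict_of_ae hw.pos] with x hx hx'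
      simp only [Pi.zero_apply, ENNReal.ofReal_eq_zero] at hx
      linarith
    rw [ae_iff] at hfalse
    simp at hfalse
    exact hB0 (by simpa using hfalse)
  by_contra htop
  rw [not_lt, top_le_iff] at htop
  have h₂ := hb 0 r hr
  rw [setLAverage_eq _ (fun x => ENNReal.ofReal (w x ^ (-(1 / (p - 1))))), htop,
    ENNReal.top_div_of_ne_top hBt, ENNReal.top_rpow_of_pos (by linarith), ENNReal.mul_top h₁] at h₂
  exact ENNReal.ofReal_ne_top (top_le_iff.1 h₂)

/-- Here H = R/w. It lies in L^q(w) because w · w^(-q) = w^(-1/(p-1)), which is integrable on Ω by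
the `A_p` condition. -/
theorem isDualField_of_bounded {p q : ℝ} (hpq : p.HolderConjugate q) {w : RN N → ℝ}
    (hw : IsMuckenhoupt p w) {Ω : Set (RN N)} (hΩ : Bornology.IsBounded Ω)
    {F : RN N → RN N} (hF : AEStronglyMeasurable F (volume.restrict Ω)) {R : ℝ}
    (hR : ∀ᵐ x ∂volume.restrict Ω, ‖F x‖ ≤ R) : IsDualField q w Ω F := by
  have hq : 0 < q := hpq.symm.pos
  have hm : AEStronglyMeasurable (fun x => (w x)⁻¹) (weightedMeasure w Ω) :=
    (hw.locallyIntegrable.aestronglyMeasurable.aemeasurable.restrict.inv.aestronglyMeasurable).mono_ac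
      (withDensity_absolutelyContinuous _ _)
  have hinv : MemLp (fun x => (w x)⁻¹) (ENNReal.ofReal q) (weightedMeasure w Ω) := by
    refine ⟨hm, ?_⟩
    rw [eLpNorm_lt_top_iff_lintegral_rpow_enorm_lt_top (by simpa using hq) ENNReal.ofReal_ne_top,
      ENNReal.toReal_ofReal hq.le, lintegral_weightedMeasure hw Ω (hm.enorm.pow_const q)]
    refine lt_of_le_of_lt (le_of_eq ?_) (hw.lintegral_rpow_lt_top hpq.lt hΩ)
    refine lintegral_congr_ae ?_
    filter_upwards [ae_restrict_of_ae hw.pos] with x hx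
    rw [Real.enorm_eq_ofReal (by positivity), ENNReal.ofReal_rpow_of_nonneg (by positivity) hq.le,
      ← ENNReal.ofReal_mul hx.le]
    congr 1
    rw [← Real.rpow_neg_one, ← Real.rpow_mul hx.le]
    nth_rewrite 1 [← Real.rpow_one (w x)]
    rw [← Real.rpow_add hx]
    congr 1
    have := hpq.sub_one_pos
    rw [hpq.conjugate_eq]
    field_simp
    ring
  refine ⟨hF, fun x => R * (w x)⁻¹, hinv.const_mul R, ?_⟩
  filter_upwards [hR, ae_restrict_of_ae hw.pos] with x hx hwx
  rwa [inv_mul_cancel_right₀ hwx.ne']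

/-! ### Uniform bounds for arctan, its square and their derivatives -/

theorem norm_arctan_le_two (t : ℝ) : ‖Real.arctan t‖ ≤ 2 := by
  rw [Real.norm_eq_abs, abs_le]
  constructor <;> linarith [Real.arctan_lt_pi_div_two t, Real.neg_pi_div_two_lt_arctan t,
    Real.pi_le_four]

theorem norm_one_div_one_add_sq_le_one (t : ℝ) : ‖1 / (1 + t ^ 2)‖ ≤ 1 := by
  rw [Real.norm_of_nonneg (by positivity), div_le_one (by positivity)]
  nlinarith [sq_nonneg t]

theorem norm_mul_le_mul_of_le {a b c d : ℝ} (h₁ : ‖a‖ ≤ c) (h₂ : ‖b‖ ≤ d) : ‖a * b‖ ≤ c * d := by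
  rw [norm_mul]
  exact mul_le_mul h₁ h₂ (norm_nonneg _) ((norm_nonneg _).trans h₁)

theorem hasDerivAt_arctan_sq (t : ℝ) :
    HasDerivAt (fun s => Real.arctan s ^ 2) (2 * Real.arctan t * (1 / (1 + t ^ 2))) t :=
  ((Real.hasDerivAt_arctan t).pow 2).congr_deriv (by simp)

theorem continuous_one_div_one_add_sq : Continuous fun t : ℝ => 1 / (1 + t ^ 2) :=
  continuous_const.div (by fun_prop) fun t => by positivity

theorem norm_arctan_sq_le (t : ℝ) : ‖Real.arctan t ^ 2‖ ≤ 4 := by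
  rw [sq]
  exact (norm_mul_le_mul_of_le (norm_arctan_le_two t) (norm_arctan_le_two t)).trans (by norm_num)

theorem norm_deriv_arctan_sq_le (t : ℝ) : ‖2 * Real.arctan t * (1 / (1 + t ^ 2))‖ ≤ 4 :=
  (norm_mul_le_mul_of_le (norm_mul_le_mul_of_le (c := 2) (by simp) (norm_arctan_le_two t))
    (norm_one_div_one_add_sq_le_one t)).trans (by norm_num)

theorem continuous_deriv_arctan_sq :
    Continuous fun t : ℝ => 2 * Real.arctan t * (1 / (1 + t ^ 2)) :=
  (continuous_const.mul Real.continuous_arctan).mul continuous_one_div_one_add_sq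

/-! ### Vanishing of a limit of test functions -/

/-- The divergence theorem for the field `x ↦ ψ(x) ⟪e, x⟫ e`. -/
theorem IsTestFunction.integral_inner_mul_gradient {Ω : Set (RN N)} {ψ : RN N → ℝ}
    (hψ : IsTestFunction 1 Ω ψ) {e : RN N} (he : ‖e‖ = 1) :
    ∫ x in Ω, (inner ℝ (inner ℝ e x • e) (gradient ψ x) : ℝ) = -∫ x in Ω, ψ x := by
  have hd : Differentiable ℝ fun x : RN N => (inner ℝ e x : ℝ) := (innerSL ℝ e).differentiable
  have hf : ∀ x : RN N, fderiv ℝ (fun x : RN N => (inner ℝ e x : ℝ)) x e = 1 := fun x => by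
    have : (fun x : RN N => (inner ℝ e x : ℝ)) = innerSL ℝ e := rfl
    rw [this, ContinuousLinearMap.fderiv, innerSL_apply_apply, real_inner_self_eq_norm_sq, he,
      one_pow]
  have hgc : Continuous fun x => fderiv ℝ ψ x e :=
    (hψ.1.continuous_fderiv one_ne_zero).clm_apply continuous_const
  have hgs : HasCompactSupport fun x => fderiv ℝ ψ x e :=
    (hψ.2.1.fderiv ℝ).comp_left (g := fun L : RN N →L[ℝ] ℝ => L e) rfl
  have hψi : Integrable ψ volume := hψ.1.continuous.integrable_of_hasCompactSupport hψ.2.1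
  have key := integral_mul_fderiv_eq_neg_fderiv_mul_of_integrable (μ := volume) (v := e)
    (f := fun x : RN N => (inner ℝ e x : ℝ)) (g := ψ) (by simpa [hf] using hψi)
    ((hd.continuous.mul hgc).integrable_of_hasCompactSupport hgs.mul_left)
    ((hd.continuous.mul hψ.1.continuous).integrable_of_hasCompactSupport hψ.2.1.mul_left)
    (fun x _ => hd x) (fun x _ => hψ.1.differentiable one_ne_zero x)
  simp only [hf, one_mul] at key
  have e₁ : ∀ x, (inner ℝ (inner ℝ e x • e) (gradient ψ x) : ℝ) = inner ℝ e x * fderiv ℝ ψ x e :=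
    fun x => by
      rw [real_inner_smul_left, inner_gradient_right]
      simp
  simp only [e₁]
  rw [setIntegral_eq_integral_of_forall_compl_eq_zero, key,
    setIntegral_eq_integral_of_forall_compl_eq_zero]
  · intro x hx
    exact image_eq_zero_of_notMem_tsupport fun hx' => hx (hψ.2.2 hx')
  · intro x hx
    have h0 : fderiv ℝ ψ x = 0 :=
      image_eq_zero_of_notMem_tsupport fun hx' => hx (hψ.2.2 (tsupport_fderiv_subset ℝ hx'))
    rw [h0]
    simp

/-- Because S vanishes at 0, the product inherits its support from φ alone. -/
theorem IsTestFunction.comp_mul_comp {n : WithTop ℕ∞} {Ω : Set (RN N)} {φ ψ : RN N → ℝ}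
    (hφ : IsTestFunction n Ω φ) (hψ : ContDiff ℝ n ψ) {S T : ℝ → ℝ} (hS : ContDiff ℝ n S)
    (hT : ContDiff ℝ n T) (hS0 : S 0 = 0) :
    IsTestFunction n Ω (fun x => S (φ x) * T (ψ x)) := by
  have hs : Function.support (fun x => S (φ x) * T (ψ x)) ⊆ Function.support φ := fun x hx h0 =>
    hx (by simp only; rw [h0, hS0, zero_mul])
  exact ⟨(hS.comp hφ.1).mul (hT.comp hψ), hφ.2.1.mono hs, (closure_mono hs).trans hφ.2.2⟩

/-- A limit of test functions whose gradient vanishes off its zero set is zero. -/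
theorem ae_eq_zero_of_gradient_eq_zero (hN : 0 < N) {p q : ℝ} (hpq : p.HolderConjugate q)
    {w : RN N → ℝ} (hw : IsMuckenhoupt p w) {Ω : Set (RN N)} (hΩ : MeasurableSet Ω)
    (hΩb : Bornology.IsBounded Ω) {d : RN N → ℝ} {G : RN N → RN N} {φ : ℕ → RN N → ℝ}
    (hφ : ∀ n, IsTestFunction ∞ Ω (φ n))
    (hlim : ∀ᵐ x ∂volume.restrict Ω, Tendsto (fun n => φ n x) atTop (𝓝 (d x)))
    (hGp : MemLp G (ENNReal.ofReal p) (weightedMeasure w Ω))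
    (hGlim : Tendsto (fun n => eLpNorm (fun x => G x - gradient (φ n) x) (ENNReal.ofReal p)
      (weightedMeasure w Ω)) atTop (𝓝 0))
    (hG : ∀ᵐ x ∂volume.restrict Ω, d x ≠ 0 → G x = 0) :
    ∀ᵐ x ∂volume.restrict Ω, d x = 0 := by
  have : IsFiniteMeasure (volume.restrict Ω) := ⟨by simpa using hΩb.measure_lt_top⟩
  have hφ1 : ∀ n, IsTestFunction 1 Ω (φ n) := fun n => (hφ n).mono (by simp)
  have hφm : ∀ n, AEStronglyMeasurable (φ n) (volume.restrict Ω) := fun n =>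
    (hφ n).1.continuous.aestronglyMeasurable
  have hdm : AEStronglyMeasurable d (volume.restrict Ω) :=
    aestronglyMeasurable_of_tendsto_ae atTop hφm hlim
  obtain ⟨e, he⟩ : ∃ e : RN N, ‖e‖ = 1 := ⟨EuclideanSpace.single ⟨0, hN⟩ 1, by simp⟩
  obtain ⟨R, hR⟩ := hΩb.exists_norm_le
  have hR' : ∀ᵐ x ∂volume.restrict Ω, ‖x‖ ≤ R := 
    (ae_restrict_iff' hΩ).2 (Eventually.of_forall hR)
  have hF : IsDualField q w Ω (fun x => (inner ℝ e x : ℝ) • e) := by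
    refine isDualField_of_bounded hpq hw hΩb (R := R)
      (Continuous.aestronglyMeasurable (by fun_prop)) ?_
    filter_upwards [hR'] with x hx
    rw [norm_smul, he, mul_one]
    exact (norm_inner_le_norm e x).trans (by rwa [he, one_mul])
  have h₁ := tendsto_integral_mul_of_tendsto_eLpNorm_one
    (b := fun n x => 2 * Real.arctan (φ n x) * (1 / (1 + φ n x ^ 2)))
    (b₀ := fun x => 2 * Real.arctan (d x) * (1 / (1 + d x ^ 2)))
    (fun n => hF.integrable_inner hpq hw ((hφ1 n).memLp_gradient hw hΩb))
    (hF.integrable_inner hpq hw hGp)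
    (hF.tendsto_inner hpq hw (fun n => (hφ1 n).memLp_gradient hw hΩb) hGp hGlim)
    (fun n => continuous_deriv_arctan_sq.comp_aestronglyMeasurable (hφm n))
    (fun n => Eventually.of_forall fun x => norm_deriv_arctan_sq_le _)
    (by filter_upwards [hlim] with x hx using (continuous_deriv_arctan_sq.tendsto _).comp hx)
  have h₂ := tendsto_integral_mul_of_tendsto_eLpNorm_one (μ := volume.restrict Ω)
    (a := fun _ _ => 1) (a₀ := fun _ => 1)
    (b := fun n x => Real.arctan (φ n x) ^ 2) (b₀ := fun x => Real.arctan (d x) ^ 2)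
    (fun n => integrable_const _) (integrable_const _) (by simp)
    (fun n => (Real.continuous_arctan.pow 2).comp_aestronglyMeasurable (hφm n))
    (fun n => Eventually.of_forall fun x => norm_arctan_sq_le _)
    (by filter_upwards [hlim] with x hx using ((Real.continuous_arctan.pow 2).tendsto _).comp hx)
  have h₃ : ∀ n, ∫ x in Ω, (inner ℝ ((inner ℝ e x : ℝ) • e) (gradient (φ n) x) : ℝ) *
      (2 * Real.arctan (φ n x) * (1 / (1 + φ n x ^ 2))) =
      -∫ x in Ω, 1 * Real.arctan (φ n x) ^ 2 := fun n => by
    have ht := (hφ1 n).comp_mul_comp (hφ1 n).1 Real.contDiff_arctan Real.contDiff_arctan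
      Real.arctan_zero
    have := ht.integral_inner_mul_gradient he
    simp only [one_mul, sq (Real.arctan _)]
    rw [← this]
    refine integral_congr_ae (Eventually.of_forall fun x => ?_)
    simp only
    rw [gradient_comp_mul_comp (hφ1 n).1 (hφ1 n).1 Real.hasDerivAt_arctan Real.hasDerivAt_arctan,
      inner_add_right, real_inner_smul_right, real_inner_smul_right]
    ring
  -- The limit of the left side of `h₃` vanishes: its integrand contains G where d ≠ 0, and
  -- arctan(d) where d = 0.
  have h₄ : ∫ x in Ω, 1 * Real.arctan (d x) ^ 2 = 0 := by
    have h := tendsto_nhds_unique (h₁.congr h₃) h₂.neg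
    rw [← neg_eq_zero, ← h]
    refine integral_eq_zero_of_ae ?_
    filter_upwards [hG] with x hx
    by_cases h0 : d x = 0
    · simp [h0]
    · simp [hx h0]
  simp only [one_mul] at h₄
  rw [integral_eq_zero_iff_of_nonneg (fun x => sq_nonneg _)] at h₄
  · filter_upwards [h₄] with x hx
    simpa using hx
  · exact Integrable.of_bound ((Real.continuous_arctan.pow 2).comp_aestronglyMeasurable hdm) 4
      (Eventually.of_forall fun x => norm_arctan_sq_le _)

/-! ### Monotonicity of the field and the singular term -/

/-- For ζ₁ ≠ ζ₂ one of the vectors is nonzero, so degeneracy makes `Abar` positive; hence its real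
power, and the whole lower bound in strong monotonicity, is positive. -/
theorem IsAdmissible.inner_sub_nonneg {p : ℝ} {w : RN N → ℝ} {Ω : Set (RN N)}
    {A : RN N → RN N → RN N} (hw : IsMuckenhoupt p w) (hA : IsAdmissible p w Ω A) :
    ∀ᵐ x ∂volume.restrict Ω, ∀ ζ₁ ζ₂ : RN N,
      0 ≤ (inner ℝ (A x ζ₁ - A x ζ₂) (ζ₁ - ζ₂) : ℝ) ∧
      ((inner ℝ (A x ζ₁ - A x ζ₂) (ζ₁ - ζ₂) : ℝ) = 0 → ζ₁ - ζ₂ = 0) := by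
  obtain ⟨c, hc, hmono⟩ := hA.strong_monotonicity
  filter_upwards [hmono, hA.degeneracy, ae_restrict_of_ae hw.pos] with x hx hd hwx ζ₁ ζ₂
  by_cases h0 : ζ₁ - ζ₂ = 0
  · simp [h0]
  have hpos : 0 < Abar w A x ζ₁ ζ₂ := by
    have h₁ := hd ζ₁
    have h₂ := hd ζ₂
    refine mul_pos (by positivity) ?_
    by_cases h : ζ₁ = 0
    · have : ζ₂ ≠ 0 := fun h' => h0 (by rw [h, h', sub_zero])
      have : 0 < ‖ζ₂‖ ^ p * w x := by positivity
      have : 0 ≤ ‖ζ₁‖ ^ p * w x := by positivity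
      linarith
    · have : 0 < ‖ζ₁‖ ^ p * w x := by positivity
      have : 0 ≤ ‖ζ₂‖ ^ p * w x := by positivity
      linarith
  have : 0 < (inner ℝ (A x ζ₁ - A x ζ₂) (ζ₁ - ζ₂) : ℝ) := lt_of_lt_of_le (by positivity) (hx ζ₁ ζ₂)
  exact ⟨this.le, fun h => absurd h this.ne'⟩

/-- The weak formulation holds with any weak gradient. -/
theorem IsWeakSolution.equation_of_hasWeakGradient {p : ℝ} {w : RN N → ℝ} {Ω : Set (RN N)}
    (hΩ : IsOpen Ω) {A : RN N → RN N → RN N} {δ : ℝ} {f u : RN N → ℝ}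
    (hu : IsWeakSolution p w Ω A δ f u) {g : RN N → RN N} (hg : HasWeakGradient Ω u g)
    {φ : RN N → ℝ} (hφ : IsTestFunction 1 Ω φ) :
    ∫ x in Ω, (inner ℝ (A x (g x)) (gradient φ x) : ℝ) = ∫ x in Ω, f x / u x ^ δ * φ x := by
  obtain ⟨g', hg', h⟩ := hu.equation
  rw [← h φ hφ]
  refine integral_congr_ae ?_
  filter_upwards [hg.ae_eq hΩ hg'] with x hx
  rw [hx]

/-- On K the bound u ≥ c gives |f/u^δ| ≤ |f|/c^δ. No such control is available up to the boundary.
-/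
theorem IsWeakSolution.integrable_indicator {p : ℝ} {w : RN N → ℝ} {Ω : Set (RN N)}
    {A : RN N → RN N → RN N} {δ : ℝ} (hδ : 0 < δ) {f u : RN N → ℝ} (hf : IntegrableOn f Ω)
    (hu : IsWeakSolution p w Ω A δ f u)
    (hum : AEStronglyMeasurable u (volume.restrict Ω)) {K : Set (RN N)} (hK : IsCompact K)
    (hKΩ : K ⊆ Ω) :
    IntegrableOn (K.indicator fun x => f x / u x ^ δ) Ω := by
  obtain ⟨c, hc, hcu⟩ := hu.locally_pos K hK hKΩ
  refine Integrable.restrict ?_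
  rw [integrable_indicator_iff hK.measurableSet]
  refine Integrable.mono' ((hf.mono_set hKΩ).norm.div_const (c ^ δ)) ?_ ?_
  · exact ((hf.mono_set hKΩ).aestronglyMeasurable.aemeasurable.div
      ((hum.mono_set hKΩ).aemeasurable.pow_const δ)).aestronglyMeasurable
  · filter_upwards [hcu] with x hx
    have h := Real.rpow_le_rpow hc.le hx hδ.le
    have h' : 0 < c ^ δ := Real.rpow_pos_of_pos hc _
    rw [norm_div, Real.norm_of_nonneg (h'.le.trans h)]
    gcongr

/-- The map t ↦ f/t^δ is nonincreasing, while arctan has the sign of its argument. -/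
theorem singular_term_mul_arctan_nonpos {δ f s t : ℝ} (hδ : 0 < δ) (hf : 0 ≤ f) (hs : 0 < s)
    (ht : 0 < t) : (f / s ^ δ - f / t ^ δ) * Real.arctan (s - t) ≤ 0 := by
  have h₁ := Real.rpow_pos_of_pos hs δ
  have h₂ := Real.rpow_pos_of_pos ht δ
  rcases le_total s t with h | h
  · refine mul_nonpos_of_nonneg_of_nonpos (sub_nonneg.2 ?_) ?_
    · exact div_le_div_of_nonneg_left hf h₁ (Real.rpow_le_rpow hs.le h hδ.le)
    · rw [← Real.arctan_zero]; exact Real.arctan_strictMono.monotone (by linarith)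
  · refine mul_nonpos_of_nonpos_of_nonneg (sub_nonpos.2 ?_) ?_
    · exact div_le_div_of_nonneg_left hf h₂ (Real.rpow_le_rpow ht.le h hδ.le)
    · rw [← Real.arctan_zero]; exact Real.arctan_strictMono.monotone (by linarith)

/-! ### Testing the difference of the equations -/

/-- The inequality obtained by testing the difference of the equations for `u₁` and `u₂` with
`arctan²(φ) arctan(u₁ - u₂)`, for a test function `φ`. -/
theorem IsWeakSolution.integral_test_le_zero {p q : ℝ} (hpq : p.HolderConjugate q)
    {w : RN N → ℝ} (hw : IsMuckenhoupt p w) {Ω : Set (RN N)} (hΩ : IsOpen Ω)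
    (hΩb : Bornology.IsBounded Ω) {A : RN N → RN N → RN N} (hA : IsAdmissible p w Ω A)
    {δ : ℝ} (hδ : 0 < δ) {f : RN N → ℝ} (hf : IntegrableOn f Ω)
    (hf_nonneg : ∀ᵐ x ∂volume.restrict Ω, 0 ≤ f x) {u₁ u₂ : RN N → ℝ}
    (hu₁ : IsWeakSolution p w Ω A δ f u₁) (hu₂ : IsWeakSolution p w Ω A δ f u₂)
    {g₁ g₂ : RN N → RN N} (hg₁ : HasWeakGradient Ω u₁ g₁) (hg₂ : HasWeakGradient Ω u₂ g₂)
    (hgp₁ : MemLp g₁ (ENNReal.ofReal p) (weightedMeasure w Ω))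
    (hgp₂ : MemLp g₂ (ENNReal.ofReal p) (weightedMeasure w Ω))
    {φ : ℕ → RN N → ℝ} (hφ : ∀ n, IsTestFunction 1 Ω (φ n))
    (hlim : ∀ᵐ x ∂volume.restrict Ω, Tendsto (fun n => φ n x) atTop (𝓝 (u₁ x - u₂ x)))
    (hglim : Tendsto (fun n => eLpNorm (fun x => (g₁ x - g₂ x) - gradient (φ n) x)
      (ENNReal.ofReal p) (weightedMeasure w Ω)) atTop (𝓝 0))
    {ψ : RN N → ℝ} (hψ : IsTestFunction 1 Ω ψ) :
    (∫ x in Ω, (inner ℝ (A x (g₁ x) - A x (g₂ x)) (gradient ψ x) : ℝ) *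
        (2 * Real.arctan (ψ x) * (1 / (1 + ψ x ^ 2)) * Real.arctan (u₁ x - u₂ x))) +
      ∫ x in Ω, (inner ℝ (A x (g₁ x) - A x (g₂ x)) (g₁ x - g₂ x) : ℝ) *
        (Real.arctan (ψ x) ^ 2 * (1 / (1 + (u₁ x - u₂ x) ^ 2))) ≤ 0 := by
  have hF₁ := hA.isDualField hpq hw hgp₁
  have hF₂ := hA.isDualField hpq hw hgp₂
  have hF := hF₁.sub hF₂
  have hGp : MemLp (fun x => g₁ x - g₂ x) (ENNReal.ofReal p) (weightedMeasure w Ω) :=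
    hgp₁.sub hgp₂
  have hgrad : ∀ {η : RN N → ℝ}, IsTestFunction 1 Ω η →
      MemLp (gradient η) (ENNReal.ofReal p) (weightedMeasure w Ω) := fun h => h.memLp_gradient hw hΩb
  have hm : ∀ {η : RN N → ℝ}, IsTestFunction 1 Ω η →
      AEStronglyMeasurable η (volume.restrict Ω) := fun h => h.1.continuous.aestronglyMeasurable
  have hdm : AEStronglyMeasurable (fun x => u₁ x - u₂ x) (volume.restrict Ω) :=
    aestronglyMeasurable_of_tendsto_ae atTop (fun n => hm (hφ n)) hlim
  have hTm : ∀ {η : RN N → ℝ}, AEStronglyMeasurable η (volume.restrict Ω) →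
      AEStronglyMeasurable (fun x => Real.arctan (η x)) (volume.restrict Ω) := fun h =>
    Real.continuous_arctan.comp_aestronglyMeasurable h
  have hSm := (Real.continuous_arctan.pow 2).comp_aestronglyMeasurable (hm hψ)
  have hS'm := continuous_deriv_arctan_sq.comp_aestronglyMeasurable (hm hψ)
  have hTlim : ∀ᵐ x ∂volume.restrict Ω, Tendsto (fun n => Real.arctan (φ n x)) atTop
      (𝓝 (Real.arctan (u₁ x - u₂ x))) := by
    filter_upwards [hlim] with x hx using (Real.continuous_arctan.tendsto _).comp hx
  have hL₁ := tendsto_integral_mul_of_tendsto_eLpNorm_one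
    (a := fun _ x => (inner ℝ (A x (g₁ x) - A x (g₂ x)) (gradient ψ x) : ℝ))
    (b := fun n x => 2 * Real.arctan (ψ x) * (1 / (1 + ψ x ^ 2)) * Real.arctan (φ n x))
    (b₀ := fun x => 2 * Real.arctan (ψ x) * (1 / (1 + ψ x ^ 2)) * Real.arctan (u₁ x - u₂ x))
    (fun _ => hF.integrable_inner hpq hw (hgrad hψ)) (hF.integrable_inner hpq hw (hgrad hψ))
    (by simp) (fun n => hS'm.mul (hTm (hm (hφ n))))
    (fun n => Eventually.of_forall fun x =>
      norm_mul_le_mul_of_le (norm_deriv_arctan_sq_le _) (norm_arctan_le_two _))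
    (by filter_upwards [hTlim] with x hx using hx.const_mul _)
  have hL₂ := tendsto_integral_mul_of_tendsto_eLpNorm_one
    (b := fun n x => Real.arctan (ψ x) ^ 2 * (1 / (1 + φ n x ^ 2)))
    (b₀ := fun x => Real.arctan (ψ x) ^ 2 * (1 / (1 + (u₁ x - u₂ x) ^ 2)))
    (fun n => hF.integrable_inner hpq hw (hgrad (hφ n)))
    (hF.integrable_inner hpq hw hGp)
    (hF.tendsto_inner hpq hw (fun n => hgrad (hφ n)) hGp hglim)
    (fun n => hSm.mul (continuous_one_div_one_add_sq.comp_aestronglyMeasurable (hm (hφ n))))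
    (fun n => Eventually.of_forall fun x =>
      norm_mul_le_mul_of_le (norm_arctan_sq_le _) (norm_one_div_one_add_sq_le_one _))
    (by filter_upwards [hlim] with x hx using
          ((continuous_one_div_one_add_sq.tendsto _).comp hx).const_mul _)
  -- Cutting the singular terms off to the support of ψ makes them integrable and costs nothing, as
  -- arctan²(ψ) vanishes outside it.
  have hr₁ := hu₁.integrable_indicator hδ hf hg₁.1.aestronglyMeasurable hψ.2.1 hψ.2.2
  have hr₂ := hu₂.integrable_indicator hδ hf hg₂.1.aestronglyMeasurable hψ.2.1 hψ.2.2
  have hR : ∀ {r : RN N → ℝ}, IntegrableOn r Ω →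
      Tendsto (fun n => ∫ x in Ω, r x * (Real.arctan (ψ x) ^ 2 * Real.arctan (φ n x))) atTop
        (𝓝 (∫ x in Ω, r x * (Real.arctan (ψ x) ^ 2 * Real.arctan (u₁ x - u₂ x)))) := fun {r} hr =>
    tendsto_integral_mul_of_tendsto_eLpNorm_one (a := fun _ => r) (fun _ => hr) hr (by simp)
      (fun n => hSm.mul (hTm (hm (hφ n))))
      (fun n => Eventually.of_forall fun x =>
        norm_mul_le_mul_of_le (norm_arctan_sq_le _) (norm_arctan_le_two _))
      (by filter_upwards [hTlim] with x hx using hx.const_mul _)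
  -- The two equations subtracted, with the gradient of arctan²(ψ) arctan(φₙ) expanded by the
  -- classical product rule.
  have hid : ∀ n, (∫ x in Ω, (inner ℝ (A x (g₁ x) - A x (g₂ x)) (gradient ψ x) : ℝ) *
        (2 * Real.arctan (ψ x) * (1 / (1 + ψ x ^ 2)) * Real.arctan (φ n x))) +
      ∫ x in Ω, (inner ℝ (A x (g₁ x) - A x (g₂ x)) (gradient (φ n) x) : ℝ) *
        (Real.arctan (ψ x) ^ 2 * (1 / (1 + φ n x ^ 2))) =
      (∫ x in Ω, (tsupport ψ).indicator (fun x => f x / u₁ x ^ δ) x *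
        (Real.arctan (ψ x) ^ 2 * Real.arctan (φ n x))) -
      ∫ x in Ω, (tsupport ψ).indicator (fun x => f x / u₂ x ^ δ) x *
        (Real.arctan (ψ x) ^ 2 * Real.arctan (φ n x)) := fun n => by
    have ht : IsTestFunction 1 Ω fun x => Real.arctan (ψ x) ^ 2 * Real.arctan (φ n x) :=
      hψ.comp_mul_comp (S := fun t => Real.arctan t ^ 2) (hφ n).1 (Real.contDiff_arctan.pow 2)
        Real.contDiff_arctan (by simp)
    have hind : ∀ r : RN N → ℝ, ∫ x in Ω, (tsupport ψ).indicator r x *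
        (Real.arctan (ψ x) ^ 2 * Real.arctan (φ n x)) =
        ∫ x in Ω, r x * (Real.arctan (ψ x) ^ 2 * Real.arctan (φ n x)) := fun r => by
      refine integral_congr_ae (Eventually.of_forall fun x => ?_)
      by_cases hx : x ∈ tsupport ψ
      · simp only [indicator_of_mem hx]
      · simp [image_eq_zero_of_notMem_tsupport hx]
    rw [hind, hind, ← hu₁.equation_of_hasWeakGradient hΩ hg₁ ht,
      ← hu₂.equation_of_hasWeakGradient hΩ hg₂ ht,
      ← integral_sub (hF₁.integrable_inner hpq hw (hgrad ht))
        (hF₂.integrable_inner hpq hw (hgrad ht)), ← integral_add]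
    · refine integral_congr_ae (Eventually.of_forall fun x => ?_)
      simp only
      rw [← inner_sub_left, gradient_comp_mul_comp (S := fun t => Real.arctan t ^ 2) hψ.1 (hφ n).1
        hasDerivAt_arctan_sq Real.hasDerivAt_arctan, inner_add_right, real_inner_smul_right,
        real_inner_smul_right]
      ring
    · exact (hF.integrable_inner hpq hw (hgrad hψ)).mul_bdd (hS'm.mul (hTm (hm (hφ n))))
        (Eventually.of_forall fun x =>
          norm_mul_le_mul_of_le (norm_deriv_arctan_sq_le _) (norm_arctan_le_two _))
    · exact (hF.integrable_inner hpq hw (hgrad (hφ n))).mul_bdd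
        (hSm.mul (continuous_one_div_one_add_sq.comp_aestronglyMeasurable (hm (hφ n))))
        (Eventually.of_forall fun x =>
          norm_mul_le_mul_of_le (norm_arctan_sq_le _) (norm_one_div_one_add_sq_le_one _))
  rw [tendsto_nhds_unique ((hL₁.add hL₂).congr hid) ((hR hr₁).sub (hR hr₂))]
  have hbdd : ∀ {r : RN N → ℝ}, IntegrableOn r Ω →
      IntegrableOn (fun x => r x * (Real.arctan (ψ x) ^ 2 * Real.arctan (u₁ x - u₂ x))) Ω :=
    fun hr => Integrable.mul_bdd hr (hSm.mul (hTm hdm)) (Eventually.of_forall fun x =>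
      norm_mul_le_mul_of_le (norm_arctan_sq_le _) (norm_arctan_le_two _))
  rw [← integral_sub (hbdd hr₁) (hbdd hr₂)]
  refine integral_nonpos_of_ae ?_
  filter_upwards [hf_nonneg, hu₁.pos, hu₂.pos] with x hfx h₁ h₂
  by_cases hx : x ∈ tsupport ψ
  · simp only [indicator_of_mem hx, Pi.zero_apply]
    have h := mul_nonpos_of_nonneg_of_nonpos (sq_nonneg (Real.arctan (ψ x)))
      (singular_term_mul_arctan_nonpos hδ hfx h₁ h₂)
    linarith
  · simp [image_eq_zero_of_notMem_tsupport hx]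

/-- The gradients of two weak solutions agree almost everywhere where the solutions differ. -/
theorem IsWeakSolution.gradient_sub_eq_zero {p q : ℝ} (hpq : p.HolderConjugate q)
    {w : RN N → ℝ} (hw : IsMuckenhoupt p w) {Ω : Set (RN N)} (hΩ : IsOpen Ω)
    (hΩb : Bornology.IsBounded Ω) {A : RN N → RN N → RN N} (hA : IsAdmissible p w Ω A)
    {δ : ℝ} (hδ : 0 < δ) {f : RN N → ℝ} (hf : IntegrableOn f Ω)
    (hf_nonneg : ∀ᵐ x ∂volume.restrict Ω, 0 ≤ f x) {u₁ u₂ : RN N → ℝ}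
    (hu₁ : IsWeakSolution p w Ω A δ f u₁) (hu₂ : IsWeakSolution p w Ω A δ f u₂)
    {g₁ g₂ : RN N → RN N} (hg₁ : HasWeakGradient Ω u₁ g₁) (hg₂ : HasWeakGradient Ω u₂ g₂)
    (hgp₁ : MemLp g₁ (ENNReal.ofReal p) (weightedMeasure w Ω))
    (hgp₂ : MemLp g₂ (ENNReal.ofReal p) (weightedMeasure w Ω))
    {φ : ℕ → RN N → ℝ} (hφ : ∀ n, IsTestFunction 1 Ω (φ n))
    (hlim : ∀ᵐ x ∂volume.restrict Ω, Tendsto (fun n => φ n x) atTop (𝓝 (u₁ x - u₂ x)))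
    (hglim : Tendsto (fun n => eLpNorm (fun x => (g₁ x - g₂ x) - gradient (φ n) x)
      (ENNReal.ofReal p) (weightedMeasure w Ω)) atTop (𝓝 0)) :
    ∀ᵐ x ∂volume.restrict Ω, u₁ x - u₂ x ≠ 0 → g₁ x - g₂ x = 0 := by
  have hGp : MemLp (fun x => g₁ x - g₂ x) (ENNReal.ofReal p) (weightedMeasure w Ω) :=
    hgp₁.sub hgp₂
  have hF := (hA.isDualField hpq hw hgp₁).sub (hA.isDualField hpq hw hgp₂)
  have hm : ∀ n, AEStronglyMeasurable (φ n) (volume.restrict Ω) := fun n =>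
    (hφ n).1.continuous.aestronglyMeasurable
  have hdm : AEStronglyMeasurable (fun x => u₁ x - u₂ x) (volume.restrict Ω) :=
    aestronglyMeasurable_of_tendsto_ae atTop hm hlim
  have hTm := Real.continuous_arctan.comp_aestronglyMeasurable hdm
  have hT'm := continuous_one_div_one_add_sq.comp_aestronglyMeasurable hdm
  have hi := hF.integrable_inner hpq hw hGp
  -- The second limit, with ψ = φₙ: here the gradient factor varies with n and converges in L¹ after
  -- pairing with the flux difference.
  have hL₁ := tendsto_integral_mul_of_tendsto_eLpNorm_one
    (b := fun n x => 2 * Real.arctan (φ n x) * (1 / (1 + φ n x ^ 2)) * Real.arctan (u₁ x - u₂ x))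
    (b₀ := fun x => 2 * Real.arctan (u₁ x - u₂ x) * (1 / (1 + (u₁ x - u₂ x) ^ 2)) *
      Real.arctan (u₁ x - u₂ x))
    (fun n => hF.integrable_inner hpq hw ((hφ n).memLp_gradient hw hΩb)) hi
    (hF.tendsto_inner hpq hw (fun n => (hφ n).memLp_gradient hw hΩb) hGp hglim)
    (fun n => (continuous_deriv_arctan_sq.comp_aestronglyMeasurable (hm n)).mul hTm)
    (fun n => Eventually.of_forall fun x =>
      norm_mul_le_mul_of_le (norm_deriv_arctan_sq_le _) (norm_arctan_le_two _))
    (by filter_upwards [hlim] with x hx using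
          ((continuous_deriv_arctan_sq.tendsto _).comp hx).mul_const _)
  have hL₂ := tendsto_integral_mul_of_tendsto_eLpNorm_one
    (a := fun _ x => (inner ℝ (A x (g₁ x) - A x (g₂ x)) (g₁ x - g₂ x) : ℝ))
    (b := fun n x => Real.arctan (φ n x) ^ 2 * (1 / (1 + (u₁ x - u₂ x) ^ 2)))
    (b₀ := fun x => Real.arctan (u₁ x - u₂ x) ^ 2 * (1 / (1 + (u₁ x - u₂ x) ^ 2)))
    (fun _ => hi) hi (by simp)
    (fun n => ((Real.continuous_arctan.pow 2).comp_aestronglyMeasurable (hm n)).mul hT'm)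
    (fun n => Eventually.of_forall fun x =>
      norm_mul_le_mul_of_le (norm_arctan_sq_le _) (norm_one_div_one_add_sq_le_one _))
    (by filter_upwards [hlim] with x hx using
          (((Real.continuous_arctan.pow 2).tendsto _).comp hx).mul_const _)
  have hle := le_of_tendsto (hL₁.add hL₂) (Eventually.of_forall fun n =>
    hu₁.integral_test_le_zero hpq hw hΩ hΩb hA hδ hf hf_nonneg hu₂ hg₁ hg₂ hgp₁ hgp₂ hφ hlim hglim
      (hφ n))
  have hi₁ : IntegrableOn (fun x => (inner ℝ (A x (g₁ x) - A x (g₂ x)) (g₁ x - g₂ x) : ℝ) *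
      (2 * Real.arctan (u₁ x - u₂ x) * (1 / (1 + (u₁ x - u₂ x) ^ 2)) *
        Real.arctan (u₁ x - u₂ x))) Ω :=
    hi.mul_bdd ((continuous_deriv_arctan_sq.comp_aestronglyMeasurable hdm).mul hTm)
    (Eventually.of_forall fun x =>
      norm_mul_le_mul_of_le (norm_deriv_arctan_sq_le _) (norm_arctan_le_two _))
  have hi₂ : IntegrableOn (fun x => (inner ℝ (A x (g₁ x) - A x (g₂ x)) (g₁ x - g₂ x) : ℝ) *
      (Real.arctan (u₁ x - u₂ x) ^ 2 * (1 / (1 + (u₁ x - u₂ x) ^ 2)))) Ω :=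
    hi.mul_bdd
    (((Real.continuous_arctan.pow 2).comp_aestronglyMeasurable hdm).mul hT'm)
    (Eventually.of_forall fun x =>
      norm_mul_le_mul_of_le (norm_arctan_sq_le _) (norm_one_div_one_add_sq_le_one _))
  rw [← integral_add hi₁ hi₂] at hle
  have hmono := hA.inner_sub_nonneg hw
  have hnn : 0 ≤ᵐ[volume.restrict Ω] fun x =>
      (inner ℝ (A x (g₁ x) - A x (g₂ x)) (g₁ x - g₂ x) : ℝ) *
        (2 * Real.arctan (u₁ x - u₂ x) * (1 / (1 + (u₁ x - u₂ x) ^ 2)) *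
          Real.arctan (u₁ x - u₂ x)) +
      (inner ℝ (A x (g₁ x) - A x (g₂ x)) (g₁ x - g₂ x) : ℝ) *
        (Real.arctan (u₁ x - u₂ x) ^ 2 * (1 / (1 + (u₁ x - u₂ x) ^ 2))) := by
    -- Both terms are multiples of arctan²(d)/(1 + d²), with factors 2 and 1; hence the 3 below.
    filter_upwards [hmono] with x hx
    have h := (hx (g₁ x) (g₂ x)).1
    have h' : 0 ≤ (inner ℝ (A x (g₁ x) - A x (g₂ x)) (g₁ x - g₂ x) : ℝ) *
      (3 * (Real.arctan (u₁ x - u₂ x) ^ 2 * (1 / (1 + (u₁ x - u₂ x) ^ 2)))) := by positivity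
    simp only [Pi.zero_apply]
    linarith
  have hzero := (integral_eq_zero_iff_of_nonneg_ae hnn (hi₁.add hi₂)).1
    (le_antisymm hle (integral_nonneg_of_ae hnn))
  filter_upwards [hzero, hmono] with x hx hmx hd
  refine (hmx _ _).2 ?_
  have hT : 0 < 3 * (Real.arctan (u₁ x - u₂ x) ^ 2 * (1 / (1 + (u₁ x - u₂ x) ^ 2))) := by
    have : Real.arctan (u₁ x - u₂ x) ≠ 0 := fun h => hd (Real.arctan_eq_zero_iff.1 h)
    positivity
  refine (mul_eq_zero.1 ?_).resolve_right hT.ne'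
  simp only [Pi.zero_apply] at hx
  linarith

end SingularWeighted

end

/-- For `0 < δ ≤ 1` the singular problem has at most one weak solution in `W_0^{1,p}(Ω,w)`. -/
theorem theorem4p1 (N : ℕ) (hN : 2 ≤ N)
    (Ω : Set (SingularWeighted.RN N)) (hΩ : SingularWeighted.IsBoundedSmoothDomain Ω)
    (p : ℝ) (hp : 1 < p)
    (w : SingularWeighted.RN N → ℝ) (hw : SingularWeighted.IsMuckenhoupt p w)
    (A : SingularWeighted.RN N → SingularWeighted.RN N → SingularWeighted.RN N)
    (hA : SingularWeighted.IsAdmissible p w Ω A)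
    (δ : ℝ) (hδ : 0 < δ) (hδ_one : δ ≤ 1)
    (f : SingularWeighted.RN N → ℝ) (hf : IntegrableOn f Ω)
    (hf_nonneg : ∀ᵐ x ∂volume.restrict Ω, 0 ≤ f x)
    (u₁ u₂ : SingularWeighted.RN N → ℝ)
    (hu₁ : SingularWeighted.IsWeakSolution p w Ω A δ f u₁)
    (hu₁X : SingularWeighted.MemW1p0 p w Ω u₁)
    (hu₂ : SingularWeighted.IsWeakSolution p w Ω A δ f u₂)
    (hu₂X : SingularWeighted.MemW1p0 p w Ω u₂) :
    ∀ᵐ x ∂volume.restrict Ω, u₁ x = u₂ x := by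
  have hpq : p.HolderConjugate (p / (p - 1)) := Real.HolderConjugate.conjExponent hp
  obtain ⟨g₁, g₂, φ, hg₁, hg₂, hgp₁, hgp₂, hφ, hlim, hglim⟩ :=
    SingularWeighted.exists_testFunction_tendsto_sub hp hw hu₁X hu₂X
  have hG := hu₁.gradient_sub_eq_zero hpq hw hΩ.isOpen hΩ.isBounded hA hδ hf hf_nonneg hu₂ hg₁ hg₂
    hgp₁ hgp₂ (fun n => (hφ n).mono (by simp)) hlim hglim
  have hd := SingularWeighted.ae_eq_zero_of_gradient_eq_zero (by omega) hpq hw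
    hΩ.isOpen.measurableSet hΩ.isBounded hφ hlim (hgp₁.sub hgp₂) hglim hG
  filter_upwards [hd] with x hx using sub_eq_zero.1 hx
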